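/- Define the Fibonacci words over the alphabet $\{a,b\}$ by $F_{-1}=b$, $F_0=a$ and $F_n=F_{n-1}F_{n-2}$ for $n\ge 1$, and let $F_\infty$ be the infinite Fibonacci word, i.e. the unique infinite word having every $F_n$, $n\ge 0$, as a prefix. The Zimin words are $Z_0=\lambda$ (the empty word) and $Z_{k+1}=Z_k\,x_{k+1}\,Z_k$ for $k\ge 0$, where $x_1,x_2,\dots$ are distinct letters. The Zimin type of a finite word $w$ is the largest $k$ such that $w$ is the image of $Z_k$ under a non-erasing morphism (one that maps every letter to a non-empty word). Let $\mathsf{ZFib}[n]$ be the Zimin type of the prefix of length $n$ of $F_\infty$, let $\phi=\frac{1+\sqrt5}{2}$ be the golden ratio, and put $a_n=\mathsf{ZFib}[n]/\log_\phi n$ for $n\ge 2$. Then the sequence $(a_n)$ has no limit (finite or infinite), $\limsup_{n\to\infty}a_n=\frac12$, $\liminf_{n\to\infty}a_n=\frac13$, and every number $c\in[\frac13,\frac12]$ is a limit point of $(a_n)$, i.e. the limit of some subsequence $(a_{n_i})$ with $n_1<n_2<\cdots$. -/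

import Mathlib

/-- The Zimin words `Z_0 = λ`, `Z_{k+1} = Z_k x_{k+1} Z_k` over the letters `x_1, x_2, …`;
the letter `x_{i+1}` is represented by the number `i`. -/
def ziminWord : ℕ → List ℕ
  | 0 => []
  | k + 1 => ziminWord k ++ k :: ziminWord k

/-- `w` is the image of `Z_k` under a non-erasing morphism. The morphism is given by the images
`h i` of the letters and acts on words by concatenation; it is non-erasing if each letter of `Z_k`
has a non-empty image. -/
def IsZiminImage {α : Type*} (k : ℕ) (w : List α) : Prop :=
  ∃ h : ℕ → List α, (∀ i ∈ ziminWord k, h i ≠ []) ∧ (ziminWord k).flatMap h = w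

/-- The Zimin type of a finite word: the largest `k` such that the word is an image of `Z_k`
under a non-erasing morphism (the maximum exists, see `zType_isGreatest`). -/
noncomputable def zType {α : Type*} (w : List α) : ℕ :=
  sSup {k | IsZiminImage k w}

theorem IsZiminImage.le_length {α : Type*} {k : ℕ} {w : List α} (hw : IsZiminImage k w) :
    k ≤ w.length := by
  obtain ⟨h, hne, rfl⟩ := hw
  induction k with
  | zero => simp
  | succ k ih =>
    have h1 := ih (fun i hi => hne i (by simp [ziminWord, hi]))
    have h2 : 0 < (h k).length := List.length_pos_iff.2 (hne k (by simp [ziminWord]))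
    simp only [ziminWord, List.flatMap_append, List.flatMap_cons, List.length_append]
    omega

theorem exists_isZiminImage {α : Type*} (w : List α) : ∃ k, IsZiminImage k w := by
  by_cases hw : w = []
  · exact ⟨0, fun _ => [], by simp [ziminWord], by simp [ziminWord, hw]⟩
  · exact ⟨1, fun _ => w, by simp [ziminWord, hw], by simp [ziminWord]⟩

theorem zType_isGreatest {α : Type*} (w : List α) :
    IsGreatest {k | IsZiminImage k w} (zType w) := by
  have hb : BddAbove {k | IsZiminImage k w} := ⟨w.length, fun k hk => hk.le_length⟩
  exact ⟨Nat.sSup_mem (exists_isZiminImage w) hb, fun k hk => le_csSup hb hk⟩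

/-- The Fibonacci words over the alphabet `{a, b}` with `a = 0`, `b = 1`, with index shifted by
one: `fibWord 0 = F_{-1} = b`, `fibWord 1 = F_0 = a`, `fibWord (n + 1) = F_n`. -/
def fibWord : ℕ → List (Fin 2)
  | 0 => [1]
  | 1 => [0]
  | n + 2 => fibWord (n + 1) ++ fibWord n

/-- The infinite Fibonacci word: its letter at (0-based) position `i` is that of `F_i`, which has
length greater than `i`. It is the unique infinite word having all `F_n`, `n ≥ 0`, as prefixes,
see `fibInf_unique`. -/
def fibInf (i : ℕ) : Fin 2 := (fibWord (i + 1)).getD i 0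

/-- The prefix of length `n` of an infinite word. -/
def wordPrefix {α : Type*} (x : ℕ → α) (n : ℕ) : List α := (List.range n).map x

theorem length_fibWord (n : ℕ) : (fibWord n).length = Nat.fib (n + 1) := by
  induction n using Nat.twoStepInduction with
  | zero => rfl
  | one => rfl
  | more n ih1 ih2 =>
    rw [fibWord, List.length_append, ih1, ih2, Nat.fib_add_two (n := n + 1), add_comm]

theorem lt_length_fibWord (n : ℕ) : n < (fibWord (n + 1)).length := by
  rw [length_fibWord]
  induction n with
  | zero => decide
  | succ n ih =>
    have h : 0 < Nat.fib (n + 1) := Nat.fib_pos.2 (by omega)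
    have h2 : Nat.fib (n + 1 + 1 + 1) = Nat.fib (n + 1) + Nat.fib (n + 1 + 1) := Nat.fib_add_two
    omega

theorem fibWord_prefix {m n : ℕ} (h : m ≤ n) : fibWord (m + 1) <+: fibWord (n + 1) := by
  induction n, h using Nat.le_induction with
  | base => exact List.prefix_rfl
  | succ n _ ih => exact ih.trans (List.prefix_append _ _)

theorem wordPrefix_fibInf (n : ℕ) :
    wordPrefix fibInf (fibWord (n + 1)).length = fibWord (n + 1) := by
  apply List.ext_getElem
  · simp [wordPrefix]
  · intro i h1 h2
    have h3 := lt_length_fibWord i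
    simp only [wordPrefix, List.getElem_map, List.getElem_range, fibInf]
    rw [List.getD_eq_getElem _ _ h3]
    rcases le_total i n with h | h
    · exact (fibWord_prefix h).getElem h3
    · exact ((fibWord_prefix h).getElem h2).symm

theorem fibInf_unique (x : ℕ → Fin 2) :
    (∀ n, wordPrefix x (fibWord (n + 1)).length = fibWord (n + 1)) ↔ x = fibInf := by
  refine ⟨fun h => funext fun i => ?_, fun h n => h ▸ wordPrefix_fibInf n⟩
  have h1 : wordPrefix x (fibWord (i + 1)).length = wordPrefix fibInf (fibWord (i + 1)).length :=
    (h i).trans (wordPrefix_fibInf i).symm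
  have h2 := List.map_inj_left.1 h1
  exact h2 i (List.mem_range.2 (lt_length_fibWord i))

/-- `ZFib[n]`: the Zimin type of the length `n` prefix of the infinite Fibonacci word. -/
noncomputable def ZFib (n : ℕ) : ℕ := zType (wordPrefix fibInf n)

/-- `a_n = ZFib[n] / log_φ n` with `φ` the golden ratio (meaningful for `n ≥ 2`). -/
noncomputable def zfibRatio (n : ℕ) : ℝ := (ZFib n : ℝ) / Real.logb Real.goldenRatio (n : ℝ)

/-! A prefix of `fibInf` is an image of `Z_{k+1}` exactly when it has a border shorter than half of
it that is an image of `Z_k`. Types are monotone along borders, so the type is the number of steps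
in a greedy descent through longest short borders.

Occurrences of prefixes are rigid: at position `fib (k+2)` the longest one has length `fib (k+3) -
2`, and at any other positive position a leading Fibonacci number can be stripped off
(`PrefixOccursAt.add_two_le_fib`, `PrefixOccursAt.of_fib_add`). Measure a length by the index of the
largest Fibonacci number below it, which is `log_φ` up to a constant. Then raising the type by one
costs about 2 indices at best (`fib_two_mul_le`) and 3 at worst (`le_three_mul_ZFib`), which yields
1/2 and 1/3. Costs 2 and 3 can be mixed in any order (`exists_chain`), so every ratio in between is
a limit point. -/

/-- The prefix of length `m` of the infinite Fibonacci word occurs at position `p`. -/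
def PrefixOccursAt (p m : ℕ) : Prop := ∀ t < m, fibInf (p + t) = fibInf t

/-! ### Zimin images and borders. -/

theorem lt_of_mem_ziminWord {k i : ℕ} (hi : i ∈ ziminWord k) : i < k := by
  induction k with
  | zero => simp [ziminWord] at hi
  | succ k ih =>
    simp only [ziminWord, List.mem_append, List.mem_cons] at hi
    rcases hi with h | h | h
    · exact (ih h).trans (Nat.lt_succ_self k)
    · omega
    · exact (ih h).trans (Nat.lt_succ_self k)

theorem isZiminImage_succ {α : Type*} {k : ℕ} {w : List α} :
    IsZiminImage (k + 1) w ↔ ∃ u v, IsZiminImage k u ∧ v ≠ [] ∧ w = u ++ (v ++ u) := by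
  constructor
  · rintro ⟨h, hne, rfl⟩
    refine ⟨(ziminWord k).flatMap h, h k, ⟨h, fun i hi => hne i (by simp [ziminWord, hi]), rfl⟩,
      hne k (by simp [ziminWord]), by simp [ziminWord]⟩
  · rintro ⟨u, v, ⟨h, hne, rfl⟩, hv, rfl⟩
    -- The letter `k` does not occur in `Z_k`, so its image can be chosen freely.
    have key : (ziminWord k).flatMap (Function.update h k v) = (ziminWord k).flatMap h := by
      apply List.flatMap_congr
      intro i hi
      rw [Function.update_of_ne (lt_of_mem_ziminWord hi).ne]
    refine ⟨Function.update h k v, fun i hi => ?_, by simp [ziminWord, key]⟩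
    by_cases hik : i = k
    · subst hik
      simpa using hv
    · rw [Function.update_of_ne hik]
      apply hne
      simp only [ziminWord, List.mem_append, List.mem_cons] at hi
      tauto

theorem wordPrefix_add {α : Type*} (x : ℕ → α) (p m : ℕ) :
    wordPrefix x (p + m) = wordPrefix x p ++ wordPrefix (fun t => x (p + t)) m := by
  simp [wordPrefix, List.range_add, Function.comp_def]

theorem length_wordPrefix {α : Type*} (x : ℕ → α) (n : ℕ) : (wordPrefix x n).length = n := by
  simp [wordPrefix]

theorem wordPrefix_eq_iff {α : Type*} {x y : ℕ → α} {n : ℕ} :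
    wordPrefix x n = wordPrefix y n ↔ ∀ t < n, x t = y t := by
  simp [wordPrefix]

theorem isZiminImage_wordPrefix_succ {k n : ℕ} :
    IsZiminImage (k + 1) (wordPrefix fibInf n) ↔ ∃ p m, n = p + m ∧ m < p ∧
      PrefixOccursAt p m ∧ IsZiminImage k (wordPrefix fibInf m) := by
  rw [isZiminImage_succ]
  constructor
  · rintro ⟨u, v, hu, hv, hw⟩
    have hv' : 0 < v.length := List.length_pos_iff.2 hv
    have hn : n = u.length + (v.length + u.length) := by
      have := congrArg List.length hw
      simpa [length_wordPrefix] using this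
    have h1 : wordPrefix fibInf u.length = u := by
      rw [hn, wordPrefix_add] at hw
      exact (List.append_inj hw (length_wordPrefix _ _)).1
    have h2 : wordPrefix (fun t => fibInf (u.length + v.length + t)) u.length = u := by
      rw [hn, ← add_assoc, wordPrefix_add, ← List.append_assoc] at hw
      exact (List.append_inj hw (by simp [length_wordPrefix])).2
    refine ⟨u.length + v.length, u.length, by omega, by omega, ?_, by rwa [h1]⟩
    exact wordPrefix_eq_iff.1 (h2.trans h1.symm)
  · rintro ⟨p, m, rfl, hmp, ho, hm⟩
    obtain ⟨d, rfl⟩ := Nat.exists_eq_add_of_lt hmp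
    refine ⟨wordPrefix fibInf m, wordPrefix (fun t => fibInf (m + t)) (d + 1), hm, ?_, ?_⟩
    · rw [← List.length_pos_iff, length_wordPrefix]
      omega
    · rw [wordPrefix_add, add_assoc m d 1, wordPrefix_add, List.append_assoc]
      congr 2
      exact wordPrefix_eq_iff.2 ho

theorem isZiminImage_ZFib (n : ℕ) : IsZiminImage (ZFib n) (wordPrefix fibInf n) :=
  (zType_isGreatest _).1

theorem le_ZFib {k n : ℕ} (h : IsZiminImage k (wordPrefix fibInf n)) : k ≤ ZFib n :=
  (zType_isGreatest _).2 h

theorem succ_ZFib_le {p m : ℕ} (hmp : m < p) (ho : PrefixOccursAt p m) :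
    ZFib m + 1 ≤ ZFib (p + m) :=
  le_ZFib (isZiminImage_wordPrefix_succ.2 ⟨p, m, rfl, hmp, ho, isZiminImage_ZFib m⟩)

/-- The Zimin type is monotone along borders. -/
theorem ZFib_le_of_prefixOccursAt {p m : ℕ} (ho : PrefixOccursAt p m) :
    ZFib m ≤ ZFib (p + m) := by
  rcases hk : ZFib m with _ | k
  · exact Nat.zero_le _
  · have h := isZiminImage_ZFib m
    rw [hk] at h
    obtain ⟨p', m', rfl, hlt, ho', hz⟩ := isZiminImage_wordPrefix_succ.1 h
    refine le_ZFib (isZiminImage_wordPrefix_succ.2 ⟨p + p', m', by omega, by omega, ?_, hz⟩)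
    intro t ht
    rw [add_assoc, ho _ (by omega), ho' t ht]

/-- The Zimin type is governed by the longest border shorter than half of the word. -/
theorem ZFib_eq_succ {p m : ℕ} (hmp : m < p) (ho : PrefixOccursAt p m)
    (hmax : ∀ p' m', p + m = p' + m' → m' < p' → PrefixOccursAt p' m' → m' ≤ m) :
    ZFib (p + m) = ZFib m + 1 := by
  refine le_antisymm ?_ (succ_ZFib_le hmp ho)
  rcases hk : ZFib (p + m) with _ | k
  · exact Nat.zero_le _
  · have h := isZiminImage_ZFib (p + m)
    rw [hk] at h
    obtain ⟨p', m', hn, hlt, ho', hz⟩ := isZiminImage_wordPrefix_succ.1 h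
    have hle := hmax p' m' hn hlt ho'
    -- Of two borders of one word, the shorter is a border of the longer.
    have hb : PrefixOccursAt (m - m') m' := by
      intro t ht
      rw [← ho (m - m' + t) (by omega), ← ho' t ht]
      congr 1
      omega
    have h1 := ZFib_le_of_prefixOccursAt hb
    rw [Nat.sub_add_cancel hle] at h1
    have h2 := le_ZFib hz
    omega

/-! ### Occurrences of prefixes in the Fibonacci word. -/

theorem fibWord_getElem? {n i : ℕ} (hi : i < Nat.fib (n + 2)) :
    (fibWord (n + 1))[i]? = some (fibInf i) := by
  rw [← wordPrefix_fibInf n, length_fibWord]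
  simp [wordPrefix, hi]

theorem fibInf_fib_add {n t : ℕ} (ht : t < Nat.fib (n + 2)) :
    fibInf (Nat.fib (n + 3) + t) = fibInf t := by
  have h4 : Nat.fib (n + 4) = Nat.fib (n + 2) + Nat.fib (n + 3) := Nat.fib_add_two
  have h1 := fibWord_getElem? (n := n + 2) (i := Nat.fib (n + 3) + t)
    (by rw [show n + 2 + 2 = n + 4 from rfl]; omega)
  have hl : (fibWord (n + 1 + 1)).length = Nat.fib (n + 3) := length_fibWord _
  rw [fibWord, List.getElem?_append_right (by omega), hl, Nat.add_sub_cancel_left,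
    fibWord_getElem? ht] at h1
  exact (Option.some.inj h1).symm

/-- Near-commutation: `F_{n-1}F_{n-2}` and `F_{n-2}F_{n-1}` differ only in their last two letters.
The bound is sharp by `fibInf_fib_add_ne`. -/
theorem prefixOccursAt_fib {k m : ℕ} (hm : m + 2 ≤ Nat.fib (k + 3)) :
    PrefixOccursAt (Nat.fib (k + 2)) m := by
  induction k generalizing m with
  | zero =>
    intro t ht
    simp [Nat.fib_add_two] at hm
    omega
  | succ k ih =>
    intro t ht
    have h4 : Nat.fib (k + 4) = Nat.fib (k + 2) + Nat.fib (k + 3) := Nat.fib_add_two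
    rw [show k + 1 + 3 = k + 4 from rfl] at hm
    rcases lt_or_ge t (Nat.fib (k + 2)) with h | h
    · exact fibInf_fib_add h
    · obtain ⟨s, rfl⟩ := Nat.exists_eq_add_of_le h
      have hs : s + 1 + 2 ≤ Nat.fib (k + 3) := by omega
      rw [ih hs s (by omega), ← add_assoc, show k + 1 + 2 = k + 3 from rfl,
        add_comm (Nat.fib (k + 3)), ← h4]
      exact fibInf_fib_add (n := k + 1) (by rw [show k + 1 + 2 = k + 3 from rfl]; omega)

theorem fibInf_fib_add_ne {k t : ℕ} (ht : t + 2 = Nat.fib (k + 3)) :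
    fibInf (Nat.fib (k + 2) + t) ≠ fibInf t := by
  induction k generalizing t with
  | zero =>
    simp [Nat.fib_add_two] at ht
    subst ht
    decide
  | succ k ih =>
    have h4 : Nat.fib (k + 4) = Nat.fib (k + 2) + Nat.fib (k + 3) := Nat.fib_add_two
    have h3 : Nat.fib 3 ≤ Nat.fib (k + 3) := Nat.fib_mono (by omega)
    have h3' : Nat.fib 3 = 2 := rfl
    rw [show k + 1 + 3 = k + 4 from rfl] at ht
    obtain ⟨s, rfl⟩ := Nat.exists_eq_add_of_le (show Nat.fib (k + 2) ≤ t by omega)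
    have h := ih (t := s) (by omega)
    rw [← add_assoc, show k + 1 + 2 = k + 3 from rfl, add_comm (Nat.fib (k + 3)), ← h4,
      fibInf_fib_add (n := k + 1) (by rw [show k + 1 + 2 = k + 3 from rfl]; omega)]
    exact h.symm

theorem exists_fib_le_lt {n : ℕ} (hn : 0 < n) :
    ∃ i, Nat.fib (i + 2) ≤ n ∧ n < Nat.fib (i + 3) := by
  have h1 : Nat.fib n.greatestFib ≤ n := Nat.fib_greatestFib_le n
  have h2 : n < Nat.fib (n.greatestFib + 1) := Nat.lt_fib_greatestFib_add_one n
  have h3 : 2 ≤ n.greatestFib := Nat.le_greatestFib.2 hn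
  obtain ⟨i, hi⟩ := Nat.exists_eq_add_of_le' h3
  rw [hi] at h1 h2
  exact ⟨i, h1, h2⟩

theorem lt_of_fib_lt_fib {i k : ℕ} (h : Nat.fib i < Nat.fib k) : i < k := by
  by_contra hc
  exact absurd (Nat.fib_mono (not_lt.1 hc)) (not_le.2 h)

theorem PrefixOccursAt.mono {p m m' : ℕ} (h : PrefixOccursAt p m) (hm : m' ≤ m) :
    PrefixOccursAt p m' := fun t ht => h t (ht.trans_le hm)

/-- Descent on `q`: strip its largest Fibonacci number until the position is itself a Fibonacci
number, where the mismatch is known. -/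
theorem PrefixOccursAt.add_two_le_fib {q k m : ℕ} (hq : 0 < q) (hqk : q < Nat.fib k)
    (h : PrefixOccursAt q m) : m + 2 ≤ Nat.fib k := by
  induction q using Nat.strong_induction_on generalizing k m with
  | _ q ih =>
    obtain ⟨i, hi1, hi2⟩ := exists_fib_le_lt hq
    have hik : i + 3 ≤ k := lt_of_fib_lt_fib (hi1.trans_lt hqk)
    have hmono : Nat.fib (i + 3) ≤ Nat.fib k := Nat.fib_mono hik
    have h3 : Nat.fib (i + 3) = Nat.fib (i + 1) + Nat.fib (i + 2) := Nat.fib_add_two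
    have hp2 : 0 < Nat.fib (i + 2) := Nat.fib_pos.2 (by omega)
    have hp1 : 0 < Nat.fib (i + 1) := Nat.fib_pos.2 (by omega)
    have hle : Nat.fib (i + 1) ≤ Nat.fib (i + 2) := Nat.fib_mono (by omega)
    obtain ⟨r, rfl⟩ := Nat.exists_eq_add_of_le hi1
    rcases Nat.eq_zero_or_pos r with rfl | hr
    · by_contra hc
      have := fibInf_fib_add_ne (k := i) (t := Nat.fib (i + 3) - 2) (by omega)
      exact this (h _ (by omega))
    -- The truncation keeps the compared letters inside the range where the shift by `fib (i + 2)`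
    -- is valid; the induction hypothesis then shows that it cuts nothing off.
    · have h0 : PrefixOccursAt r (min m (Nat.fib (i + 1) - 1)) := by
        intro t ht
        have h1 := h t (by omega)
        rw [add_assoc, prefixOccursAt_fib (k := i) (m := r + t + 1) (by omega) _ (by omega)] at h1
        exact h1
      have := ih r (by omega) hr (k := i + 1) (by omega) h0
      omega

theorem PrefixOccursAt.of_fib_add {j q m : ℕ} (hq : 0 < q) (hqj : q < Nat.fib (j + 1))
    (h : PrefixOccursAt (Nat.fib (j + 2) + q) m) : PrefixOccursAt q m := by
  have h3 : Nat.fib (j + 3) = Nat.fib (j + 1) + Nat.fib (j + 2) := Nat.fib_add_two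
  have hle : Nat.fib (j + 1) ≤ Nat.fib (j + 2) := Nat.fib_mono (by omega)
  have h0 : PrefixOccursAt q (min m (Nat.fib (j + 1) - 1)) := by
    intro t ht
    have h1 := h t (by omega)
    rw [add_assoc, prefixOccursAt_fib (k := j) (m := q + t + 1) (by omega) _ (by omega)] at h1
    exact h1
  have h1 := h0.add_two_le_fib hq hqj
  exact h0.mono (by omega)

/-! ### Growth of the type along Fibonacci indices. -/

theorem fib_two_mul_le {k n : ℕ} (h : IsZiminImage k (wordPrefix fibInf n)) :
    Nat.fib (2 * k) ≤ n := by
  induction k generalizing n with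
  | zero => simp
  | succ k ih =>
    obtain ⟨p, m, rfl, hlt, ho, hz⟩ := isZiminImage_wordPrefix_succ.1 h
    have hm := ih hz
    rcases k with _ | k
    · simp
      omega
    · have e1 : 2 * (k + 1) = 2 * k + 2 := by ring
      have e2 : 2 * (k + 1 + 1) = 2 * k + 4 := by ring
      rw [e1] at hm
      rw [e2]
      have h4 : Nat.fib (2 * k + 4) = Nat.fib (2 * k + 2) + Nat.fib (2 * k + 3) := Nat.fib_add_two
      have h3 : Nat.fib (2 * k + 3) = Nat.fib (2 * k + 1) + Nat.fib (2 * k + 2) := Nat.fib_add_two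
      have hle : Nat.fib (2 * k + 1) ≤ Nat.fib (2 * k + 2) := Nat.fib_mono (by omega)
      -- Otherwise `p` lies strictly between `fib (2k+2)` and `fib (2k+3)`; stripping `fib (2k+2)`
      -- leaves a position below `fib (2k+1)`, too small for a border of length at least `fib
      -- (2k+2)`.
      by_contra hc
      obtain ⟨q, rfl⟩ := Nat.exists_eq_add_of_lt (hm.trans_lt hlt)
      have := (PrefixOccursAt.of_fib_add (j := 2 * k) (q := q + 1) (by omega) (by omega)
        ho).add_two_le_fib (k := 2 * k + 1) (by omega) (by omega)
      omega

/-- Some short border always lies at most 3 Fibonacci indices lower; the 4 absorbs the small cases.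
-/
theorem le_three_mul_ZFib {k n : ℕ} (h : Nat.fib k ≤ n) : k ≤ 3 * ZFib n + 4 := by
  induction n using Nat.strong_induction_on generalizing k with
  | _ n ih =>
    by_cases hk : k ≤ 4
    · omega
    · have hpos : 0 < Nat.fib k := Nat.fib_pos.2 (by omega)
      obtain ⟨i, hi1, hi2⟩ := exists_fib_le_lt (hpos.trans_le h)
      have hik : k < i + 3 := lt_of_fib_lt_fib (h.trans_lt hi2)
      obtain ⟨j, rfl⟩ : ∃ j, i = j + 3 := ⟨i - 3, by omega⟩
      rw [show j + 3 + 2 = j + 5 from rfl] at hi1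
      rw [show j + 3 + 3 = j + 6 from rfl] at hi2
      have h6 : Nat.fib (j + 6) = Nat.fib (j + 4) + Nat.fib (j + 5) := Nat.fib_add_two
      have h5 : Nat.fib (j + 5) = Nat.fib (j + 3) + Nat.fib (j + 4) := Nat.fib_add_two
      have h4 : Nat.fib (j + 4) = Nat.fib (j + 2) + Nat.fib (j + 3) := Nat.fib_add_two
      have p2 : 0 < Nat.fib (j + 2) := Nat.fib_pos.2 (by omega)
      have p3 : 0 < Nat.fib (j + 3) := Nat.fib_pos.2 (by omega)
      obtain ⟨r, rfl⟩ := Nat.exists_eq_add_of_le hi1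
      -- The threshold is where the border of period `fib (j + 4)` stops being shorter than its
      -- period. Below it the index drops by 2; above it period `fib (j + 5)` leaves `r`, a drop of
      -- 3.
      rcases lt_or_ge r (Nat.fib (j + 2)) with hr | hr
      · have ho : PrefixOccursAt (Nat.fib (j + 4)) (Nat.fib (j + 3) + r) :=
          prefixOccursAt_fib (k := j + 2) (by rw [show j + 2 + 3 = j + 5 from rfl]; omega)
        have h1 := succ_ZFib_le (by omega) ho
        have h2 := ih (Nat.fib (j + 3) + r) (by omega) (k := j + 3) (by omega)
        rw [show Nat.fib (j + 4) + (Nat.fib (j + 3) + r) = Nat.fib (j + 5) + r by omega] at h1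
        omega
      · have ho : PrefixOccursAt (Nat.fib (j + 5)) r :=
          prefixOccursAt_fib (k := j + 3) (by rw [show j + 3 + 3 = j + 6 from rfl]; omega)
        have h1 := succ_ZFib_le (by omega) ho
        have h2 := ih r (by omega) (k := j + 2) (by omega)
        omega

/-- The cheap step: the new length has index 2 higher. A longer short border would have a period
strictly between `fib (k+2)` and `fib (k+3)`, which rigidity excludes. -/
theorem ZFib_fib_add_three {k n : ℕ} (h1 : Nat.fib (k + 2) ≤ n) (h2 : n < Nat.fib (k + 3)) :
    ZFib (Nat.fib (k + 3) + n) = ZFib n + 1 := by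
  have h3 : Nat.fib (k + 3) = Nat.fib (k + 1) + Nat.fib (k + 2) := Nat.fib_add_two
  have h4 : Nat.fib (k + 4) = Nat.fib (k + 2) + Nat.fib (k + 3) := Nat.fib_add_two
  have p2 : 0 < Nat.fib (k + 2) := Nat.fib_pos.2 (by omega)
  refine ZFib_eq_succ h2
    (prefixOccursAt_fib (k := k + 1) (by rw [show k + 1 + 3 = k + 4 from rfl]; omega)) ?_
  intro p m hn hlt ho
  by_contra hc
  have hle : Nat.fib (k + 1) ≤ Nat.fib (k + 2) := Nat.fib_mono (by omega)
  obtain ⟨q, rfl⟩ := Nat.exists_eq_add_of_le (show Nat.fib (k + 2) ≤ p by omega)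
  have := (ho.of_fib_add (by omega) (by omega)).add_two_le_fib (k := k + 1) (by omega) (by omega)
  omega

/-- The expensive step: the new length has index 3 higher. -/
theorem ZFib_fib_add_five {k n : ℕ} (h1 : Nat.fib (k + 2) ≤ n) (h2 : n < Nat.fib (k + 3)) :
    ZFib (Nat.fib (k + 5) + n) = ZFib n + 1 := by
  have h3 : Nat.fib (k + 3) = Nat.fib (k + 1) + Nat.fib (k + 2) := Nat.fib_add_two
  have h4 : Nat.fib (k + 4) = Nat.fib (k + 2) + Nat.fib (k + 3) := Nat.fib_add_two
  have h5 : Nat.fib (k + 5) = Nat.fib (k + 3) + Nat.fib (k + 4) := Nat.fib_add_two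
  have h6 : Nat.fib (k + 6) = Nat.fib (k + 4) + Nat.fib (k + 5) := Nat.fib_add_two
  have p2 : 0 < Nat.fib (k + 2) := Nat.fib_pos.2 (by omega)
  refine ZFib_eq_succ (by omega)
    (prefixOccursAt_fib (k := k + 3) (by rw [show k + 3 + 3 = k + 6 from rfl]; omega)) ?_
  intro p m hn hlt ho
  by_contra hc
  have hle : Nat.fib (k + 1) ≤ Nat.fib (k + 2) := Nat.fib_mono (by omega)
  -- The period exceeds half of `fib (k+5) + n`, and `n ≥ fib (k+2)` makes that half at least `fib
  -- (k+4)`.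
  obtain ⟨q, rfl⟩ := Nat.exists_eq_add_of_le (show Nat.fib (k + 4) ≤ p by omega)
  have hoq : PrefixOccursAt q m := PrefixOccursAt.of_fib_add (j := k + 2) (by omega)
    (by rw [show k + 2 + 1 = k + 3 from rfl]; omega) ho
  have hm := hoq.add_two_le_fib (k := k + 3) (by omega) (by omega)
  -- The bound `m + 2 ≤ fib (k+3)` forces `q > n`, so a second Fibonacci number can be stripped.
  obtain ⟨r, rfl⟩ := Nat.exists_eq_add_of_le (show Nat.fib (k + 2) ≤ q by omega)
  have := (hoq.of_fib_add (by omega) (by omega)).add_two_le_fib (k := k + 1) (by omega) (by omega)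
  omega

/-- Every index sequence with increments 2 and 3 is realised by a chain of prefixes whose Zimin
types increase by one. -/
theorem exists_chain (κ : ℕ → ℕ) (hκ : ∀ i, κ (i + 1) = κ i + 2 ∨ κ (i + 1) = κ i + 3) :
    ∃ s : ℕ → ℕ, StrictMono s ∧ ∀ i, Nat.fib (κ i + 2) ≤ s i ∧ s i < Nat.fib (κ i + 3) ∧
      ZFib (s i) = ZFib (s 0) + i := by
  let s : ℕ → ℕ := fun i => Nat.rec (Nat.fib (κ 0 + 2))
    (fun i n => if κ (i + 1) = κ i + 2 then Nat.fib (κ i + 3) + n else Nat.fib (κ i + 5) + n) i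
  have hs : ∀ i, s (i + 1) =
      if κ (i + 1) = κ i + 2 then Nat.fib (κ i + 3) + s i else Nat.fib (κ i + 5) + s i :=
    fun i => rfl
  refine ⟨s, strictMono_nat_of_lt_succ fun i => ?_, fun i => ?_⟩
  · have h3 : 0 < Nat.fib (κ i + 3) := Nat.fib_pos.2 (by omega)
    have h5 : 0 < Nat.fib (κ i + 5) := Nat.fib_pos.2 (by omega)
    rw [hs]
    split_ifs <;> omega
  · induction i with
    | zero =>
      refine ⟨le_rfl, ?_, rfl⟩
      have h3 : Nat.fib (κ 0 + 3) = Nat.fib (κ 0 + 1) + Nat.fib (κ 0 + 2) := Nat.fib_add_two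
      have : 0 < Nat.fib (κ 0 + 1) := Nat.fib_pos.2 (by omega)
      change Nat.fib (κ 0 + 2) < _
      omega
    | succ i ih =>
      obtain ⟨ih1, ih2, ih3⟩ := ih
      have h3 : Nat.fib (κ i + 3) = Nat.fib (κ i + 1) + Nat.fib (κ i + 2) := Nat.fib_add_two
      have h4 : Nat.fib (κ i + 4) = Nat.fib (κ i + 2) + Nat.fib (κ i + 3) := Nat.fib_add_two
      have h5 : Nat.fib (κ i + 5) = Nat.fib (κ i + 3) + Nat.fib (κ i + 4) := Nat.fib_add_two
      have h6 : Nat.fib (κ i + 6) = Nat.fib (κ i + 4) + Nat.fib (κ i + 5) := Nat.fib_add_two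
      rw [hs]
      split_ifs with hc
      · rw [hc, show κ i + 2 + 2 = κ i + 4 from rfl, show κ i + 2 + 3 = κ i + 5 from rfl,
          ZFib_fib_add_three ih1 ih2]
        refine ⟨?_, ?_, ?_⟩ <;> omega
      · rw [(hκ i).resolve_left hc, show κ i + 3 + 2 = κ i + 5 from rfl,
          show κ i + 3 + 3 = κ i + 6 from rfl, ZFib_fib_add_five ih1 ih2]
        refine ⟨?_, ?_, ?_⟩ <;> omega

/-! ### From Fibonacci indices to logarithms, and limit points. -/

theorem goldenRatio_pow_le_fib (n : ℕ) : Real.goldenRatio ^ n ≤ Nat.fib (n + 2) := by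
  induction n using Nat.twoStepInduction with
  | zero => simp
  | one =>
    have : Nat.fib 3 = 2 := rfl
    simpa [this] using Real.goldenRatio_lt_two.le
  | more n ih1 ih2 =>
    rw [pow_add, Real.goldenRatio_sq, Nat.fib_add_two (n := n + 2), Nat.cast_add]
    rw [pow_succ] at ih2
    rw [show n + 2 + 1 = n + 1 + 2 from rfl]
    linarith

theorem fib_le_goldenRatio_pow (n : ℕ) : (Nat.fib (n + 1) : ℝ) ≤ Real.goldenRatio ^ n := by
  induction n using Nat.twoStepInduction with
  | zero => simp
  | one => simpa using Real.one_lt_goldenRatio.le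
  | more n ih1 ih2 =>
    rw [pow_add, Real.goldenRatio_sq, Nat.fib_add_two (n := n + 1), Nat.cast_add]
    rw [pow_succ] at ih2
    linarith

theorem le_logb_of_fib_le {k n : ℕ} (h : Nat.fib (k + 2) ≤ n) :
    (k : ℝ) ≤ Real.logb Real.goldenRatio n := by
  have hpos : 0 < Nat.fib (k + 2) := Nat.fib_pos.2 (by omega)
  rw [Real.le_logb_iff_rpow_le Real.one_lt_goldenRatio (by exact_mod_cast hpos.trans_le h),
    Real.rpow_natCast]
  exact (goldenRatio_pow_le_fib k).trans (by exact_mod_cast h)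

theorem logb_le_of_le_fib {k n : ℕ} (hn : 0 < n) (h : n ≤ Nat.fib (k + 1)) :
    Real.logb Real.goldenRatio n ≤ k := by
  rw [Real.logb_le_iff_le_rpow Real.one_lt_goldenRatio (by exact_mod_cast hn), Real.rpow_natCast]
  exact le_trans (by exact_mod_cast h) (fib_le_goldenRatio_pow k)

theorem two_mul_ZFib_le {n : ℕ} (hn : 0 < n) :
    2 * (ZFib n : ℝ) ≤ Real.logb Real.goldenRatio n + 2 := by
  have h := fib_two_mul_le (isZiminImage_ZFib n)
  rcases hk : ZFib n with _ | k
  · have : 0 ≤ Real.logb Real.goldenRatio n :=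
      Real.logb_nonneg Real.one_lt_goldenRatio (by exact_mod_cast hn)
    simp
    linarith
  · rw [hk] at h
    have := le_logb_of_fib_le (k := 2 * k) h
    push_cast at this ⊢
    linarith

theorem le_three_mul_ZFib_real {n : ℕ} (hn : 0 < n) :
    Real.logb Real.goldenRatio n ≤ 3 * (ZFib n : ℝ) + 4 := by
  obtain ⟨i, hi1, hi2⟩ := exists_fib_le_lt hn
  have h1 : ((i + 2 : ℕ) : ℝ) ≤ 3 * ZFib n + 4 := by exact_mod_cast le_three_mul_ZFib hi1
  exact (logb_le_of_le_fib hn hi2.le).trans h1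

theorem tendsto_logb_goldenRatio :
    Filter.Tendsto (fun n : ℕ => Real.logb Real.goldenRatio n) Filter.atTop Filter.atTop :=
  (Real.tendsto_logb_atTop Real.one_lt_goldenRatio).comp tendsto_natCast_atTop_atTop

theorem tendsto_add_div_logb (a b : ℝ) :
    Filter.Tendsto (fun n : ℕ => a + b / Real.logb Real.goldenRatio n) Filter.atTop (nhds a) := by
  simpa using (tendsto_logb_goldenRatio.const_div_atTop b).const_add a

theorem zfibRatio_le : ∀ᶠ n : ℕ in Filter.atTop,
    zfibRatio n ≤ 1 / 2 + 1 / Real.logb Real.goldenRatio n := by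
  filter_upwards [tendsto_logb_goldenRatio.eventually_gt_atTop 0, Filter.eventually_gt_atTop 0]
    with n hl hn
  have := two_mul_ZFib_le hn
  rw [zfibRatio, div_le_iff₀ hl, add_mul, div_mul_cancel₀ _ hl.ne']
  linarith

theorem le_zfibRatio : ∀ᶠ n : ℕ in Filter.atTop,
    1 / 3 + (-4 / 3) / Real.logb Real.goldenRatio n ≤ zfibRatio n := by
  filter_upwards [tendsto_logb_goldenRatio.eventually_gt_atTop 0, Filter.eventually_gt_atTop 0]
    with n hl hn
  have := le_three_mul_ZFib_real hn
  rw [zfibRatio, le_div_iff₀ hl, add_mul, div_mul_cancel₀ _ hl.ne']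
  linarith

theorem floor_mul_succ {x : ℝ} (h2 : 2 ≤ x) (h3 : x ≤ 3) (i : ℕ) :
    ⌊x * (i + 1 : ℕ)⌋₊ = ⌊x * i⌋₊ + 2 ∨ ⌊x * (i + 1 : ℕ)⌋₊ = ⌊x * i⌋₊ + 3 := by
  have hx : 0 ≤ x * i := by positivity
  have hx' : 0 ≤ x * (i + 1 : ℕ) := by positivity
  have h1 : ⌊x * i⌋₊ + 2 ≤ ⌊x * (i + 1 : ℕ)⌋₊ := by
    apply Nat.le_floor
    have := Nat.floor_le hx
    push_cast
    linarith
  have h4 : ⌊x * (i + 1 : ℕ)⌋₊ < ⌊x * i⌋₊ + 4 := by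
    rw [Nat.floor_lt hx']
    have := Nat.lt_floor_add_one (x * i)
    push_cast
    linarith
  omega

theorem exists_subseq_tendsto {c : ℝ} (hc : c ∈ Set.Icc (1 / 3 : ℝ) (1 / 2)) :
    ∃ s : ℕ → ℕ, StrictMono s ∧
      Filter.Tendsto (fun i => zfibRatio (s i)) Filter.atTop (nhds c) := by
  obtain ⟨hc1, hc2⟩ := hc
  have hc0 : 0 < c := by linarith
  have hx2 : 2 ≤ c⁻¹ := by
    rw [le_inv_comm₀ (by norm_num) hc0]
    linarith
  have hx3 : c⁻¹ ≤ 3 := by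
    rw [inv_le_comm₀ hc0 (by norm_num)]
    linarith
  -- Average cost `c⁻¹` per unit of type: since `2 ≤ c⁻¹ ≤ 3`, the floors of its multiples increase
  -- by 2 or 3. Thus `log_φ (s i)` is `c⁻¹ * i` up to a bounded error.
  obtain ⟨s, hs, h⟩ := exists_chain (fun i => ⌊c⁻¹ * i⌋₊) (floor_mul_succ hx2 hx3)
  refine ⟨s, hs, ?_⟩
  have hlim : ∀ b, Filter.Tendsto (fun i => c + b / Real.logb Real.goldenRatio (s i))
      Filter.atTop (nhds c) := fun b => (tendsto_add_div_logb c b).comp hs.tendsto_atTop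
  have hlog := tendsto_logb_goldenRatio.comp hs.tendsto_atTop
  have hpos : ∀ i, 0 < s i := fun i => (Nat.fib_pos.2 (by omega)).trans_le (h i).1
  have hlo : ∀ i : ℕ, c⁻¹ * i - 1 ≤ Real.logb Real.goldenRatio (s i) := fun i => by
    have h1 := le_logb_of_fib_le (h i).1
    have h2 := Nat.lt_floor_add_one (c⁻¹ * i)
    linarith
  have hhi : ∀ i : ℕ, Real.logb Real.goldenRatio (s i) ≤ c⁻¹ * i + 2 := fun i => by
    have h1 := logb_le_of_le_fib (k := ⌊c⁻¹ * i⌋₊ + 2) (hpos i) (h i).2.1.le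
    have h2 := Nat.floor_le (show 0 ≤ c⁻¹ * (i : ℝ) by positivity)
    push_cast at h1
    linarith
  have hci : ∀ i : ℕ, c * (c⁻¹ * i) = i := fun i => by field_simp
  refine tendsto_of_tendsto_of_tendsto_of_le_of_le' (hlim (-2 * c)) (hlim (ZFib (s 0) + c)) ?_ ?_
  · filter_upwards [hlog.eventually_gt_atTop 0] with i hl
    simp only [Function.comp_apply] at hl
    have h1 := mul_le_mul_of_nonneg_left (hhi i) hc0.le
    rw [mul_add, hci] at h1
    rw [zfibRatio, le_div_iff₀ hl, add_mul, div_mul_cancel₀ _ hl.ne', (h i).2.2]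
    push_cast
    have : (0 : ℝ) ≤ ZFib (s 0) := Nat.cast_nonneg _
    linarith
  · filter_upwards [hlog.eventually_gt_atTop 0] with i hl
    simp only [Function.comp_apply] at hl
    have h1 := mul_le_mul_of_nonneg_left (hlo i) hc0.le
    rw [mul_sub, hci] at h1
    rw [zfibRatio, div_le_iff₀ hl, add_mul, div_mul_cancel₀ _ hl.ne', (h i).2.2]
    push_cast
    linarith

theorem exists_subseq_tendsto_ereal {c : ℝ} (hc : c ∈ Set.Icc (1 / 3 : ℝ) (1 / 2)) :
    ∃ s : ℕ → ℕ, Filter.Tendsto s Filter.atTop Filter.atTop ∧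
      Filter.Tendsto (fun n => (zfibRatio n : EReal)) (Filter.map s Filter.atTop)
        (nhds (c : EReal)) := by
  obtain ⟨s, hs, h⟩ := exists_subseq_tendsto hc
  refine ⟨s, hs.tendsto_atTop, Filter.tendsto_map'_iff.2 ?_⟩
  exact (continuous_coe_real_ereal.tendsto c).comp h

theorem limsup_zfibRatio :
    Filter.limsup (fun n => (zfibRatio n : EReal)) Filter.atTop = ((1 / 2 : ℝ) : EReal) := by
  apply le_antisymm
  · have h := (continuous_coe_real_ereal.tendsto _).comp (tendsto_add_div_logb (1 / 2) 1)
    rw [← h.limsup_eq]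
    refine Filter.limsup_le_limsup ?_
    filter_upwards [zfibRatio_le] with n hn
    -- In `EReal` limsup and liminf are monotone without boundedness side conditions, so the
    -- eventual estimate suffices.
    exact EReal.coe_le_coe_iff.2 hn
  · obtain ⟨s, hs, h⟩ := exists_subseq_tendsto_ereal (c := 1 / 2) (by norm_num)
    rw [← h.limsup_eq]
    exact Filter.limsup_le_limsup_of_le hs

theorem liminf_zfibRatio :
    Filter.liminf (fun n => (zfibRatio n : EReal)) Filter.atTop = ((1 / 3 : ℝ) : EReal) := by
  apply le_antisymm
  · obtain ⟨s, hs, h⟩ := exists_subseq_tendsto_ereal (c := 1 / 3) (by norm_num)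
    rw [← h.liminf_eq]
    exact Filter.liminf_le_liminf_of_le hs
  · have h := (continuous_coe_real_ereal.tendsto _).comp (tendsto_add_div_logb (1 / 3) (-4 / 3))
    rw [← h.liminf_eq]
    refine Filter.liminf_le_liminf ?_
    filter_upwards [le_zfibRatio] with n hn
    exact EReal.coe_le_coe_iff.2 hn

theorem mainTheorem6 :
    -- no limit, finite or infinite
    (¬ ∃ L : EReal, Filter.Tendsto (fun n => (zfibRatio n : EReal)) Filter.atTop (nhds L)) ∧
    Filter.limsup (fun n => (zfibRatio n : EReal)) Filter.atTop = ((1 / 2 : ℝ) : EReal) ∧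
    Filter.liminf (fun n => (zfibRatio n : EReal)) Filter.atTop = ((1 / 3 : ℝ) : EReal) ∧
    -- each number of the interval is the limit of a subsequence
    (∀ c ∈ Set.Icc (1 / 3 : ℝ) (1 / 2), ∃ s : ℕ → ℕ, StrictMono s ∧
      Filter.Tendsto (fun i => zfibRatio (s i)) Filter.atTop (nhds c)) := by
  refine ⟨?_, limsup_zfibRatio, liminf_zfibRatio, fun c hc => exists_subseq_tendsto hc⟩
  rintro ⟨L, hL⟩
  -- A limit would force limsup and liminf to agree, that is 1/3 = 1/2.
  have h := hL.limsup_eq.symm.trans limsup_zfibRatio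
  rw [← hL.liminf_eq, liminf_zfibRatio, EReal.coe_eq_coe_iff] at h
  norm_num at h
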